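/- **Setting.** Fix a nonempty totally ordered set $D$ of objects and a set of code call names $d{:}f$, each with an arity. A *term* is an object of $D$ or a variable. An *(atomic) expression* $\mathrm{ie}=\mathbf{in}(X, d{:}f(t_1,\dots,t_n))$ has terms $t_i$ as arguments and a bound main variable $X$. A *state* $S$ is a set of ground atoms $\mathbf{in}(o, d{:}f(c_1,\dots,c_n))$; for an assignment $\theta$ of objects to variables, $[\mathrm{ie}]_{S,\theta}=\{o : \mathbf{in}(o,d{:}f(t_1\theta,\dots,t_n\theta))\in S\}$. We write $\mathrm{ie}\to \mathrm{ie}'$ if $[\mathrm{ie}]_{S,\theta}\subseteq[\mathrm{ie}']_{S,\theta}$ for all $S,\theta$. An *invariant condition* is built with $\wedge,\vee$ from $\text{true}$, $\text{false}$ and atoms $t_1\ \mathrm{op}\ t_2$, $\mathrm{op}\in\{\le,\ge,<,>,=\}$. A *simple invariant* has the form $\mathrm{ic}\Rightarrow \mathrm{ie}\ \Re\ \mathrm{ie}'$ with $\Re\in\{\subseteq,=\}$. A state $S$ satisfies it if $[\mathrm{ie}]_{S,\theta}\ \Re\ [\mathrm{ie}']_{S,\theta}$ for every $\theta$ under which $\mathrm{ic}$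 is true. $\mathcal I\models \mathrm{inv}$ means that every state satisfying all members of $\mathcal I$ satisfies $\mathrm{inv}$; $\mathrm{inv}'$ *entails* $\mathrm{inv}$ if $\{\mathrm{inv}'\}\models \mathrm{inv}$; $\mathrm{Taut}$ is the set of simple invariants satisfied by all states. Let $\mathbf{simplify}$ be any map on conditions that sends valid conditions to $\text{true}$, unsatisfiable ones to $\text{false}$, and every condition to an equivalent one. Let $\mathrm{Chk\_Ent}(\mathrm{ic}_1\Rightarrow \mathrm{ie}_1\,\Re_1\,\mathrm{ie}_1',\ \mathrm{ic}_2\Rightarrow \mathrm{ie}_2\,\Re_2\,\mathrm{ie}_2')$ hold iff $\mathrm{ic}_2$ implies $\mathrm{ic}_1$ under all assignments, $\Re_2$ is $\subseteq$, $\mathrm{ie}_2\to \mathrm{ie}_1$ and $\mathrm{ie}_1'\to \mathrm{ie}_2'$. For a set $Y$ of simple invariants, call $e$ *linked to* $e'$ *under* $\varphi$ if $e\to e'$, or if $Y$ contains $\varphi_1\Rightarrow p\subseteq q$, $\varphi_2\Rightarrow e\subseteq p$, $\varphi_3\Rightarrow q\subseteq e'$ with $\varphi$ implying $\varphi_1\wedge\varphi_2\wedge\varphi_3$.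 For $\mathrm{inv}_k=(\mathrm{ic}_k\Rightarrow \mathrm{ie}_k\,\Re_k\,\mathrm{ie}_k')$, $k=1,2$: * $\mathbf{Combine\_1}(\mathrm{inv}_1,\mathrm{inv}_2,Y)$ returns $\mathrm{inv}=(\mathbf{simplify}(\mathrm{ic}_1\wedge \mathrm{ic}_2)\Rightarrow \mathrm{ie}_1\,\Re\,\mathrm{ie}_2')$ if $\mathrm{ie}_1'$ is linked to $\mathrm{ie}_2$ under $\mathrm{ic}_1\wedge\mathrm{ic}_2$, the simplified condition is not $\text{false}$, and no $j\in Y$ has $\mathrm{Chk\_Ent}(j,\mathrm{inv})$; here $\Re$ is $=$ if $\Re_1,\Re_2$ are both $=$ and $\mathrm{ie}_2$ is also linked to $\mathrm{ie}_1'$ under $\mathrm{ic}_1\wedge\mathrm{ic}_2$, and $\subseteq$ otherwise. * $\mathbf{Combine\_2}(\mathrm{inv}_1,\mathrm{inv}_2)$: if $\Re_1,\Re_2$ are both $\subseteq$, $\theta$ is a most general unifier of $\mathrm{ie}_2,\mathrm{ie}_1'$ and $\gamma$ is one of $\mathrm{ie}_2'\theta,\mathrm{ie}_1\theta$, it returns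 $\mathbf{simplify}((\mathrm{ic}_1\wedge \mathrm{ic}_2)\theta\gamma)\Rightarrow \mathrm{ie}_1\theta\gamma=\mathrm{ie}_1'\theta\gamma$, unless the simplified condition is $\text{false}$. * $\mathbf{Combine\_3}(\mathrm{inv}_1,\mathrm{inv}_2)$: if $\Re_1=\Re_2$, $\theta$ is a most general unifier of $\mathrm{ie}_1,\mathrm{ie}_2$ and $\gamma$ is one of $\mathrm{ie}_1'\theta,\mathrm{ie}_2'\theta$, it returns $\mathbf{simplify}((\mathrm{ic}_1\vee \mathrm{ic}_2)\theta\gamma)\Rightarrow \mathrm{ie}_1\theta\gamma\,\Re_1\,\mathrm{ie}_1'\theta\gamma$. (Most general unifiers are unique only up to renaming of variables; the results for all choices are taken.) Let $\mathrm{split}(Y)$ be $Y$ together with the two inclusions $\mathrm{ic}\Rightarrow \mathrm{ie}\subseteq \mathrm{ie}'$ and $\mathrm{ic}\Rightarrow \mathrm{ie}'\subseteq \mathrm{ie}$ for each equality $\mathrm{ic}\Rightarrow \mathrm{ie}=\mathrm{ie}'$ in $Y$. Let $C_{\mathcal I}(X)$ consist of $\mathcal I\cup X$ and all invariants returned by $\mathbf{Combine\_1}(\cdot,\cdot,Y)$,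 $\mathbf{Combine\_2}$ and $\mathbf{Combine\_3}$ on pairs of members of $Y=\mathrm{split}(X\cup\mathcal I)$. Put $C_{\mathcal I}\uparrow^0=\mathrm{Taut}$, $C_{\mathcal I}\uparrow^{i+1}=C_{\mathcal I}(C_{\mathcal I}\uparrow^i)$ and $C_{\mathcal I}\uparrow^\omega=\bigcup_{i\ge 0}C_{\mathcal I}\uparrow^i$. **Corollary (All entailed invariants are subsumed in $C_{\mathcal I}\uparrow^\omega$).** Let $\mathcal I$ be a finite set of simple invariants and $\mathrm{inv}$ a simple invariant, with relation symbols $\subseteq$ or $=$. If $\mathcal I\models \mathrm{inv}$, then there is $\mathrm{inv}'\in C_{\mathcal I}\uparrow^\omega$ such that $\mathrm{inv}'$ entails $\mathrm{inv}$. -/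

import Mathlib

namespace CodeCallInv

/-- Terms: an object of the domain `D`, or a variable. -/
inductive Term (D : Type*) where
  | const (c : D) : Term D
  | var (v : ℕ) : Term D

/-- An assignment of objects to the variables. -/
abbrev Assignment (D : Type*) := ℕ → D

/-- A substitution of terms for variables. -/
abbrev Subst (D : Type*) := ℕ → Term D

def Term.eval {D : Type*} (θ : Assignment D) : Term D → D
  | .const c => c
  | .var v => θ v

def Term.subst {D : Type*} (σ : Subst D) : Term D → Term D
  | .const c => .const c
  | .var v => σ v

/-- The comparison symbols of invariant condition atoms. -/
inductive Op where
  | le | ge | lt | gt | eq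

def Op.Holds {D : Type*} [LinearOrder D] : Op → D → D → Prop
  | .le, a, b => a ≤ b
  | .ge, a, b => a ≥ b
  | .lt, a, b => a < b
  | .gt, a, b => a > b
  | .eq, a, b => a = b

/-- Invariant conditions: built from `true`, `false` and atoms `t₁ op t₂` by `∧` and `∨`. -/
inductive IC (D : Type*) where
  | tt : IC D
  | ff : IC D
  | atom (op : Op) (t₁ t₂ : Term D) : IC D
  | and (φ ψ : IC D) : IC D
  | or (φ ψ : IC D) : IC D

/-- Truth of an invariant condition under an assignment. -/
def IC.Holds {D : Type*} [LinearOrder D] (θ : Assignment D) : IC D → Prop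
  | .tt => True
  | .ff => False
  | .atom op t₁ t₂ => op.Holds (t₁.eval θ) (t₂.eval θ)
  | .and φ ψ => φ.Holds θ ∧ ψ.Holds θ
  | .or φ ψ => φ.Holds θ ∨ ψ.Holds θ

def IC.subst {D : Type*} (σ : Subst D) : IC D → IC D
  | .tt => .tt
  | .ff => .ff
  | .atom op t₁ t₂ => .atom op (t₁.subst σ) (t₂.subst σ)
  | .and φ ψ => .and (φ.subst σ) (ψ.subst σ)
  | .or φ ψ => .or (φ.subst σ) (ψ.subst σ)

/-- `ψ` follows from `φ` under every assignment. -/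
def IC.Implies {D : Type*} [LinearOrder D] (φ ψ : IC D) : Prop :=
  ∀ θ : Assignment D, φ.Holds θ → ψ.Holds θ

/-- The specification of a `simplify` routine: it returns `true` on valid conditions, `false` on
unsatisfiable ones, and some equivalent condition otherwise. -/
def IsSimplify {D : Type*} [LinearOrder D] (simplify : IC D → IC D) : Prop :=
  ∀ φ : IC D,
    ((∀ θ : Assignment D, φ.Holds θ) → simplify φ = .tt) ∧
    ((∀ θ : Assignment D, ¬ φ.Holds θ) → simplify φ = .ff) ∧
    (∀ θ : Assignment D, (simplify φ).Holds θ ↔ φ.Holds θ)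

variable {F : Type*} {ar : F → ℕ} {D : Type*}

/-- An atomic code call condition `in(X, d:f(t₁,…,tₙ))`. The elements of `F` are the code call
names `d:f`, with arities `ar`. The main variable `X` is bound (it ranges over the objects
returned by the code call), so its name is not recorded. -/
structure Expr (ar : F → ℕ) (D : Type*) where
  name : F
  args : Fin (ar name) → Term D

def Expr.subst (σ : Subst D) (e : Expr ar D) : Expr ar D :=
  ⟨e.name, fun i => (e.args i).subst σ⟩

/-- A ground atomic code call condition `in(obj, d:f(c₁,…,cₙ))`. -/
structure GroundAtom (ar : F → ℕ) (D : Type*) where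
  name : F
  args : Fin (ar name) → D
  obj : D

/-- A state of an agent: the set of ground code call conditions that are true in it. -/
abbrev State (ar : F → ℕ) (D : Type*) := Set (GroundAtom ar D)

/-- The denotation of an atomic code call condition in the state `S` under the assignment `θ`. -/
def Expr.den (S : State ar D) (θ : Assignment D) (e : Expr ar D) : Set D :=
  {o | (⟨e.name, fun i => (e.args i).eval θ, o⟩ : GroundAtom ar D) ∈ S}

/-- `e → e'`: the denotation of `e` is included in that of `e'`, for all states and assignments.
This is the relation decided by a complete implication check. -/
def Expr.Implies (e e' : Expr ar D) : Prop :=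
  ∀ (S : State ar D) (θ : Assignment D), e.den S θ ⊆ e'.den S θ

inductive Rel where
  | sub | eq

def Rel.Holds {α : Type*} : Rel → Set α → Set α → Prop
  | .sub, A, B => A ⊆ B
  | .eq, A, B => A = B

/-- A simple invariant `ic ⟹ lhs rel rhs`. -/
structure Inv (ar : F → ℕ) (D : Type*) where
  ic : IC D
  lhs : Expr ar D
  rel : Rel
  rhs : Expr ar D

/-- A state satisfies an invariant if all ground instances of the invariant are true in it. -/
def Inv.Sat [LinearOrder D] (S : State ar D) (inv : Inv ar D) : Prop :=
  ∀ θ : Assignment D, inv.ic.Holds θ → inv.rel.Holds (inv.lhs.den S θ) (inv.rhs.den S θ)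

/-- `I ⊨ inv`. -/
def Entails [LinearOrder D] (I : Set (Inv ar D)) (inv : Inv ar D) : Prop :=
  ∀ S : State ar D, (∀ i ∈ I, i.Sat S) → inv.Sat S

/-- The invariants that are true in all states. -/
def Taut (ar : F → ℕ) (D : Type*) [LinearOrder D] : Set (Inv ar D) :=
  {inv | ∀ S : State ar D, inv.Sat S}

/-- The syntactic entailment check `Chk_Ent(inv₁, inv₂)`. -/
def ChkEnt [LinearOrder D] (i₁ i₂ : Inv ar D) : Prop :=
  i₂.ic.Implies i₁.ic ∧
  ((i₁.rel = .sub ∧ i₂.rel = .sub) ∨ (i₁.rel = .eq ∧ i₂.rel = .sub)) ∧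
  i₂.lhs.Implies i₁.lhs ∧
  i₁.rhs.Implies i₂.rhs

/-- Either `e → e'`, or `Y` contains inclusions `e ⊆ p`, `p ⊆ q`, `q ⊆ e'` all of whose conditions
follow from `φ`. -/
def Linked [LinearOrder D] (Y : Set (Inv ar D)) (φ : IC D) (e e' : Expr ar D) : Prop :=
  e.Implies e' ∨
  ∃ (φ₁ φ₂ φ₃ : IC D) (p q : Expr ar D),
    (⟨φ₁, p, .sub, q⟩ : Inv ar D) ∈ Y ∧
    (⟨φ₂, e, .sub, p⟩ : Inv ar D) ∈ Y ∧
    (⟨φ₃, q, .sub, e'⟩ : Inv ar D) ∈ Y ∧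
    φ.Implies (.and φ₁ (.and φ₂ φ₃))

open Classical in
/-- The relation symbol of the invariant derived by `Combine_1`. -/
noncomputable def derivedRel [LinearOrder D] (Y : Set (Inv ar D)) (i₁ i₂ : Inv ar D) : Rel :=
  if i₁.rel = .eq ∧ i₂.rel = .eq ∧ Linked Y (.and i₁.ic i₂.ic) i₂.lhs i₁.rhs
  then .eq else .sub

/-- `Combine_1(i₁, i₂, Y)` returns `inv` (and not NIL). -/
def Combine1 [LinearOrder D] (simplify : IC D → IC D) (Y : Set (Inv ar D))
    (i₁ i₂ inv : Inv ar D) : Prop :=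
  Linked Y (.and i₁.ic i₂.ic) i₁.rhs i₂.lhs ∧
  simplify (.and i₁.ic i₂.ic) ≠ .ff ∧
  inv = ⟨simplify (.and i₁.ic i₂.ic), i₁.lhs, derivedRel Y i₁ i₂, i₂.rhs⟩ ∧
  ¬ ∃ j ∈ Y, ChkEnt j inv

/-- `θ` is a most general unifier of `e` and `e'`. -/
def IsMGU (θ : Subst D) (e e' : Expr ar D) : Prop :=
  e.subst θ = e'.subst θ ∧
  ∀ σ : Subst D, e.subst σ = e'.subst σ → ∃ δ : Subst D, ∀ v, σ v = (θ v).subst δ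

/-- `Combine_2(i₁, i₂)` returns `inv` (and not NIL), for some choice of the most general unifiers.
The second unifier is computed after the first one has been applied, so that `θγ` unifies both
pairs of expressions. -/
def Combine2 (simplify : IC D → IC D) (i₁ i₂ inv : Inv ar D) : Prop :=
  i₁.rel = .sub ∧ i₂.rel = .sub ∧
  ∃ θ γ : Subst D,
    IsMGU θ i₂.lhs i₁.rhs ∧ IsMGU γ (i₂.rhs.subst θ) (i₁.lhs.subst θ) ∧
    simplify (((IC.and i₁.ic i₂.ic).subst θ).subst γ) ≠ .ff ∧
    inv = ⟨simplify (((IC.and i₁.ic i₂.ic).subst θ).subst γ),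
      (i₁.lhs.subst θ).subst γ, .eq, (i₁.rhs.subst θ).subst γ⟩

/-- `Combine_3(i₁, i₂)` returns `inv` (and not NIL), for some choice of the most general unifiers
(computed one after the other, as in `Combine2`). -/
def Combine3 (simplify : IC D → IC D) (i₁ i₂ inv : Inv ar D) : Prop :=
  i₁.rel = i₂.rel ∧
  ∃ θ γ : Subst D,
    IsMGU θ i₁.lhs i₂.lhs ∧ IsMGU γ (i₁.rhs.subst θ) (i₂.rhs.subst θ) ∧
    inv = ⟨simplify (((IC.or i₁.ic i₂.ic).subst θ).subst γ),
      (i₁.lhs.subst θ).subst γ, i₁.rel, (i₁.rhs.subst θ).subst γ⟩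

/-- `Y` together with the two inclusions that make up each equality in `Y`. -/
def split (Y : Set (Inv ar D)) : Set (Inv ar D) :=
  Y ∪ {inv | ∃ (φ : IC D) (e e' : Expr ar D), (⟨φ, e, .eq, e'⟩ : Inv ar D) ∈ Y ∧
    (inv = ⟨φ, e, .sub, e'⟩ ∨ inv = ⟨φ, e', .sub, e⟩)}

/-- The operator `C_I` on sets of invariants. -/
def C [LinearOrder D] (simplify : IC D → IC D) (I X : Set (Inv ar D)) : Set (Inv ar D) :=
  {inv | ∃ i₁ ∈ split (X ∪ I), ∃ i₂ ∈ split (X ∪ I), Combine1 simplify (split (X ∪ I)) i₁ i₂ inv} ∪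
  {inv | ∃ i₁ ∈ split (X ∪ I), ∃ i₂ ∈ split (X ∪ I), Combine2 simplify i₁ i₂ inv} ∪
  {inv | ∃ i₁ ∈ split (X ∪ I), ∃ i₂ ∈ split (X ∪ I), Combine3 simplify i₁ i₂ inv} ∪
  (I ∪ X)

/-- The finite powers of `C_I`, starting from the tautologies. -/
def power [LinearOrder D] (simplify : IC D → IC D) (I : Set (Inv ar D)) : ℕ → Set (Inv ar D)
  | 0 => Taut ar D
  | n + 1 => C simplify I (power simplify I n)

/-- The union of all finite powers of `C_I`. -/
def powerOmega [LinearOrder D] (simplify : IC D → IC D) (I : Set (Inv ar D)) : Set (Inv ar D) :=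
  ⋃ n, power simplify I n

end CodeCallInv

/-!
Call a name together with objects as its arguments a *ground head*; the denotation of an
expression depends only on its ground head. After every equality has been split into two
inclusions, `I` demands ground inclusions between ground heads, and `I` entails `φ ⇒ e ⊆ e'` if
and only if, for each assignment satisfying `φ`, the ground head of `e'` is reachable from that of
`e` by such steps (`reach_of_entails`; only this direction is needed). Completeness therefore
means that one derived invariant covers all the paths between two names `f` and `g`.

*One path.* `Combine3` of an invariant with itself renames its variables injectively
(`derivable_rename`), `Combine1` gives transitivity (`derivable_trans`), and tautologies of the
form `s̄ = t̄ ⇒ f(s̄) ⊆ f(t̄)` replace the arguments by fresh variables (`derivable_transport`).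
Hence each path is an instance of a derived inclusion `ψ ⇒ f(x̄) ⊆ g(ȳ)` with fixed distinct
variables `x̄`, `ȳ`; the other variables of `ψ` are in effect existentially quantified.

*All paths.* The paths may have unbounded length, but every path has a witnessing assignment that
can be changed freely as long as the order type of finitely many variables over the finite set `K`
of constants of `I` is kept (`exists_derivable_of_reach`). By Higman's lemma, applied to the
finite chains of values labelled with the elements of `K` and the endpoint variables that they
represent, finitely many derived inclusions cover all paths (`exists_lt_sameType`), and `Combine3`
forms their disjunction (`exists_derivable_cover`). An equality is obtained by `Combine2` from the
two opposite covering inclusions, once their conditions have been renamed apart.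

If `D` has a single object, expressions with the same name denote the same set in every state, so
`ChkEnt` compares expressions only by their names, and the syntactic normal form above may not be
derivable. There `Combine3` with a tautology whose condition is `false` specializes the sides to
`f(c,…,c)` and `g(c,…,c)` (`exists_derivable_constExpr`).
-/

namespace CodeCallInv

variable {F : Type*} {ar : F → ℕ} {D : Type*}

/-! ### Ground heads and denotations -/

/-- The code call `d:f(c₁,…,cₙ)` obtained by evaluating the arguments of an expression. -/
def Expr.ground (θ : Assignment D) (e : Expr ar D) : Σ f : F, (Fin (ar f) → D) :=
  ⟨e.name, fun i => (e.args i).eval θ⟩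

theorem Expr.den_congr (S : State ar D) {θ θ' : Assignment D} {e e' : Expr ar D}
    (h : e.ground θ = e'.ground θ') : e.den S θ = e'.den S θ' :=
  congrArg (fun a : Σ f : F, (Fin (ar f) → D) =>
    {o | (⟨a.1, a.2, o⟩ : GroundAtom ar D) ∈ S}) h

theorem Expr.name_eq_of_ground_eq {θ θ' : Assignment D} {e e' : Expr ar D}
    (h : e.ground θ = e'.ground θ') : e.name = e'.name :=
  congrArg Sigma.fst h

theorem Expr.implies_refl (e : Expr ar D) : e.Implies e := fun _ _ => subset_rfl

theorem Expr.ground_eq_of_implies [Nonempty D] {e e' : Expr ar D} (h : e.Implies e')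
    (θ : Assignment D) : e.ground θ = e'.ground θ := by
  obtain ⟨o⟩ := ‹Nonempty D›
  have := @h {g | (⟨g.name, g.args⟩ : Σ f : F, (Fin (ar f) → D)) = e.ground θ} θ o rfl
  exact Eq.symm this

theorem Term.eq_of_eval_eq [Nontrivial D] {s t : Term D}
    (h : ∀ θ : Assignment D, s.eval θ = t.eval θ) : s = t := by
  cases s with
  | const c =>
    cases t with
    | const d => exact congrArg _ (h fun _ => c)
    | var v =>
      obtain ⟨d, hd⟩ := exists_ne c
      exact absurd (h fun _ => d).symm hd
  | var u =>
    cases t with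
    | const c =>
      obtain ⟨d, hd⟩ := exists_ne c
      exact absurd (h fun _ => d) hd
    | var v =>
      obtain ⟨c, d, hcd⟩ := exists_pair_ne D
      by_contra hne
      have huv : v ≠ u := fun e => hne (e ▸ rfl)
      have := h fun w => if w = u then c else d
      simp only [Term.eval, if_true, if_neg huv] at this
      exact hcd this

/-- Over a domain with two objects the complete implication check is syntactic equality. -/
theorem Expr.eq_of_implies [Nontrivial D] {e e' : Expr ar D} (h : e.Implies e') : e = e' := by
  have hg := Expr.ground_eq_of_implies h
  obtain ⟨f, s⟩ := e
  obtain ⟨g, t⟩ := e'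
  obtain rfl : f = g := Expr.name_eq_of_ground_eq (hg fun _ => Classical.arbitrary D)
  have : s = t := funext fun i => Term.eq_of_eval_eq fun θ =>
    congrFun (eq_of_heq (Sigma.mk.inj (hg θ)).2) i
  rw [this]

/-! ### Substitutions -/

theorem Term.subst_var (t : Term D) : t.subst Term.var = t := by cases t <;> rfl

theorem Expr.subst_var (e : Expr ar D) : e.subst Term.var = e := by
  simp only [Expr.subst, Term.subst_var]

theorem IC.subst_var (φ : IC D) : φ.subst Term.var = φ := by
  induction φ <;> simp_all [IC.subst, Term.subst_var]

theorem Term.eval_rename (π : ℕ → ℕ) (θ : Assignment D) (t : Term D) :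
    (t.subst fun v => .var (π v)).eval θ = t.eval (θ ∘ π) := by cases t <;> rfl

theorem Expr.ground_rename (π : ℕ → ℕ) (θ : Assignment D) (e : Expr ar D) :
    (e.subst fun v => .var (π v)).ground θ = e.ground (θ ∘ π) := by
  simp only [Expr.ground, Expr.subst, Term.eval_rename]

theorem IC.holds_rename [LinearOrder D] (π : ℕ → ℕ) (θ : Assignment D) (φ : IC D) :
    (φ.subst fun v => .var (π v)).Holds θ ↔ φ.Holds (θ ∘ π) := by
  induction φ <;> simp_all [IC.subst, IC.Holds, Term.eval_rename]

/-- Every injective renaming of the variables is a most general unifier of an expression with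
itself. -/
theorem isMGU_rename {π : ℕ → ℕ} (hπ : π.Injective) (e : Expr ar D) :
    IsMGU (fun v => .var (π v)) e e :=
  ⟨rfl, fun σ _ => ⟨fun w => σ (Function.invFun π w), fun v => by
    simp only [Term.subst, Function.leftInverse_invFun hπ v]⟩⟩

theorem isMGU_var (e : Expr ar D) : IsMGU Term.var e e :=
  isMGU_rename Function.injective_id e

/-- The expression `f(c,…,c)`. -/
def constExpr (ar : F → ℕ) (c : D) (f : F) : Expr ar D := ⟨f, fun _ => .const c⟩

/-- Over a one-element domain every expression unifies with `f(c,…,c)`. -/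
theorem exists_isMGU_constExpr [Subsingleton D] (c : D) (e : Expr ar D) :
    ∃ θ : Subst D, IsMGU θ e (constExpr ar c e.name) ∧
      e.subst θ = constExpr ar c e.name := by
  classical
  have key : ∀ σ : Subst D, e.subst σ = constExpr ar c e.name ↔
      ∀ i, (e.args i).subst σ = .const c := by
    intro σ
    simp only [Expr.subst, constExpr, Expr.mk.injEq, heq_eq_eq, true_and, funext_iff]
  let θ : Subst D := fun v => if ∃ i, e.args i = .var v then .const c else .var v
  have hθ : e.subst θ = constExpr ar c e.name := by
    rw [key]
    intro i
    cases hi : e.args i with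
    | const d => exact congrArg _ (Subsingleton.elim d c)
    | var v => exact if_pos ⟨i, hi⟩
  refine ⟨θ, ⟨hθ, fun σ hσ => ⟨σ, fun v => ?_⟩⟩, hθ⟩
  by_cases hv : ∃ i, e.args i = .var v
  · obtain ⟨i, hi⟩ := hv
    have h1 : θ v = .const c := if_pos ⟨i, hi⟩
    have h2 := (key σ).1 hσ i
    rw [hi] at h2
    rw [h1]
    exact h2
  · have h1 : θ v = .var v := if_neg hv
    rw [h1]
    rfl

/-! ### Conditions depend only on an order type over the constants -/

/-- `θ` and `θ'` give the variables below `N` the same order type over the objects in `K`. -/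
def SameType [LinearOrder D] (K : Set D) (N : ℕ) (θ θ' : Assignment D) : Prop :=
  (∀ u < N, ∀ v < N, θ u < θ v ↔ θ' u < θ' v) ∧
  ∀ u < N, ∀ c ∈ K, (θ u < c ↔ θ' u < c) ∧ (c < θ u ↔ c < θ' u)

/-- `t` is a constant from `K` or a variable below `N`. -/
def Term.Within (K : Set D) (N : ℕ) : Term D → Prop
  | .const c => c ∈ K
  | .var v => v < N

/-- All constants of the condition are in `K` and all its variables are below `N`. -/
def IC.Within (K : Set D) (N : ℕ) : IC D → Prop
  | .tt => True
  | .ff => True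
  | .atom _ t₁ t₂ => t₁.Within K N ∧ t₂.Within K N
  | .and φ ψ => φ.Within K N ∧ ψ.Within K N
  | .or φ ψ => φ.Within K N ∧ ψ.Within K N

/-- All constants of the expression are in `K` and all its variables are below `N`. -/
def Expr.Within (K : Set D) (N : ℕ) (e : Expr ar D) : Prop :=
  ∀ i, (e.args i).Within K N

theorem Term.Within.mono {K K' : Set D} {N N' : ℕ} (hK : K ⊆ K') (hN : N ≤ N') {t : Term D}
    (h : t.Within K N) : t.Within K' N' := by
  cases t with
  | const c => exact hK h
  | var v => exact lt_of_lt_of_le h hN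

theorem IC.Within.mono {K K' : Set D} {N N' : ℕ} (hK : K ⊆ K') (hN : N ≤ N') {φ : IC D}
    (h : φ.Within K N) : φ.Within K' N' := by
  induction φ with
  | tt => trivial
  | ff => trivial
  | atom op s t => exact ⟨h.1.mono hK hN, h.2.mono hK hN⟩
  | and φ ψ ih₁ ih₂ => exact ⟨ih₁ h.1, ih₂ h.2⟩
  | or φ ψ ih₁ ih₂ => exact ⟨ih₁ h.1, ih₂ h.2⟩

theorem Expr.Within.mono {K K' : Set D} {N N' : ℕ} (hK : K ⊆ K') (hN : N ≤ N') {e : Expr ar D}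
    (h : e.Within K N) : e.Within K' N' := fun i => (h i).mono hK hN

theorem Term.exists_within (t : Term D) : ∃ (K : Finset D) (N : ℕ), t.Within (K : Set D) N := by
  cases t with
  | const c => exact ⟨{c}, 0, Finset.mem_coe.2 (Finset.mem_singleton_self c)⟩
  | var v => exact ⟨∅, v + 1, Nat.lt_succ_self v⟩

theorem IC.exists_within (φ : IC D) : ∃ (K : Finset D) (N : ℕ), φ.Within (K : Set D) N := by
  classical
  have two : ∀ K₁ K₂ : Finset D, (K₁ : Set D) ⊆ ↑(K₁ ∪ K₂) ∧ (K₂ : Set D) ⊆ ↑(K₁ ∪ K₂) :=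
    fun K₁ K₂ => ⟨by simp, by simp⟩
  induction φ with
  | tt => exact ⟨∅, 0, trivial⟩
  | ff => exact ⟨∅, 0, trivial⟩
  | atom op s t =>
    obtain ⟨K₁, N₁, h₁⟩ := s.exists_within
    obtain ⟨K₂, N₂, h₂⟩ := t.exists_within
    exact ⟨K₁ ∪ K₂, max N₁ N₂, h₁.mono (two _ _).1 (le_max_left _ _),
      h₂.mono (two _ _).2 (le_max_right _ _)⟩
  | and φ ψ ih₁ ih₂ =>
    obtain ⟨K₁, N₁, h₁⟩ := ih₁
    obtain ⟨K₂, N₂, h₂⟩ := ih₂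
    exact ⟨K₁ ∪ K₂, max N₁ N₂, h₁.mono (two _ _).1 (le_max_left _ _),
      h₂.mono (two _ _).2 (le_max_right _ _)⟩
  | or φ ψ ih₁ ih₂ =>
    obtain ⟨K₁, N₁, h₁⟩ := ih₁
    obtain ⟨K₂, N₂, h₂⟩ := ih₂
    exact ⟨K₁ ∪ K₂, max N₁ N₂, h₁.mono (two _ _).1 (le_max_left _ _),
      h₂.mono (two _ _).2 (le_max_right _ _)⟩

theorem Expr.exists_within (e : Expr ar D) :
    ∃ (K : Finset D) (N : ℕ), e.Within (K : Set D) N := by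
  classical
  choose K N h using fun i => (e.args i).exists_within
  exact ⟨Finset.univ.biUnion K, Finset.univ.sup N, fun i => (h i).mono
    (Finset.coe_subset.2 (Finset.subset_biUnion_of_mem K (Finset.mem_univ i)))
    (Finset.le_sup (Finset.mem_univ i))⟩

theorem SameType.eval_lt [LinearOrder D] {K : Set D} {N : ℕ} {θ θ' : Assignment D}
    (h : SameType K N θ θ') {s t : Term D} (hs : s.Within K N) (ht : t.Within K N) :
    s.eval θ < t.eval θ ↔ s.eval θ' < t.eval θ' := by
  cases s with
  | const c =>
    cases t with
    | const d => exact Iff.rfl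
    | var v => exact (h.2 v ht c hs).2
  | var u =>
    cases t with
    | const d => exact (h.2 u hs d ht).1
    | var v => exact h.1 u hs v ht

theorem SameType.eval_eq [LinearOrder D] {K : Set D} {N : ℕ} {θ θ' : Assignment D}
    (h : SameType K N θ θ') {s t : Term D} (hs : s.Within K N) (ht : t.Within K N) :
    s.eval θ = t.eval θ ↔ s.eval θ' = t.eval θ' := by
  have h₁ := h.eval_lt hs ht
  have h₂ := h.eval_lt ht hs
  rw [le_antisymm_iff, le_antisymm_iff, ← not_lt, ← not_lt, ← not_lt, ← not_lt, h₁, h₂]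

theorem SameType.holds [LinearOrder D] {K : Set D} {N : ℕ} {θ θ' : Assignment D}
    (h : SameType K N θ θ') {φ : IC D} (hφ : φ.Within K N) : φ.Holds θ ↔ φ.Holds θ' := by
  induction φ with
  | tt => exact Iff.rfl
  | ff => exact Iff.rfl
  | atom op s t =>
    have h₁ := h.eval_lt hφ.1 hφ.2
    have h₂ := h.eval_lt hφ.2 hφ.1
    cases op with
    | le => exact not_lt.symm.trans ((not_congr h₂).trans not_lt)
    | ge => exact not_lt.symm.trans ((not_congr h₁).trans not_lt)
    | lt => exact h₁
    | gt => exact h₂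
    | eq => exact h.eval_eq hφ.1 hφ.2
  | and φ ψ ih₁ ih₂ => exact and_congr (ih₁ hφ.1) (ih₂ hφ.2)
  | or φ ψ ih₁ ih₂ => exact or_congr (ih₁ hφ.1) (ih₂ hφ.2)

theorem SameType.ground_eq [LinearOrder D] {K : Set D} {N : ℕ} {θ θ' : Assignment D}
    (h : SameType K N θ θ') {e e' : Expr ar D} (he : e.Within K N) (he' : e'.Within K N)
    (heq : e.ground θ = e'.ground θ) : e.ground θ' = e'.ground θ' := by
  obtain ⟨f, s⟩ := e
  obtain ⟨g, t⟩ := e'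
  obtain rfl : f = g := Expr.name_eq_of_ground_eq heq
  have h₁ := eq_of_heq (Sigma.mk.inj heq).2
  have h₂ : (fun i => (s i).eval θ') = fun i => (t i).eval θ' :=
    funext fun i => (h.eval_eq (he i) (he' i)).1 (congrFun h₁ i)
  exact congrArg (Sigma.mk f) h₂

theorem SameType.comp [LinearOrder D] {K : Set D} {N N' : ℕ} {θ θ' : Assignment D}
    (h : SameType K N θ θ') (π : ℕ → ℕ) (hπ : ∀ v < N', π v < N) :
    SameType K N' (θ ∘ π) (θ' ∘ π) :=
  ⟨fun u hu v hv => h.1 _ (hπ u hu) _ (hπ v hv), fun u hu => h.2 _ (hπ u hu)⟩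

/-- The condition expressing that two expressions with the same name have equal arguments. -/
theorem exists_ic_ground_eq [LinearOrder D] {e e' : Expr ar D} (h : e.name = e'.name) :
    ∃ φ : IC D, ∀ θ, φ.Holds θ ↔ e.ground θ = e'.ground θ := by
  obtain ⟨f, s⟩ := e
  obtain ⟨g, t⟩ := e'
  obtain rfl : f = g := h
  have key : ∀ (n : ℕ) (s t : Fin n → Term D), ∃ φ : IC D, ∀ θ, φ.Holds θ ↔
      ∀ i, (s i).eval θ = (t i).eval θ := by
    intro n
    induction n with
    | zero => exact fun s t => ⟨.tt, fun θ => ⟨fun _ i => i.elim0, fun _ => trivial⟩⟩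
    | succ n ih =>
      intro s t
      obtain ⟨φ, hφ⟩ := ih (fun i => s i.succ) (fun i => t i.succ)
      refine ⟨.and (.atom .eq (s 0) (t 0)) φ, fun θ => ?_⟩
      rw [Fin.forall_fin_succ, ← hφ]
      rfl
  obtain ⟨φ, hφ⟩ := key _ s t
  refine ⟨φ, fun θ => (hφ θ).trans ?_⟩
  simp only [Expr.ground, Sigma.mk.injEq, heq_eq_eq, true_and, funext_iff]

/-- Finitely many constants suffice for all inclusions obtained from a finite set of invariants. -/
theorem exists_finset_within {I : Set (Inv ar D)} (hI : I.Finite) : ∃ K : Finset D,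
    ∀ φ e e', (⟨φ, e, .sub, e'⟩ : Inv ar D) ∈ split I →
      ∃ N, φ.Within (K : Set D) N ∧ e.Within (K : Set D) N ∧ e'.Within (K : Set D) N := by
  classical
  choose K₁ N₁ h₁ using fun i : Inv ar D => i.ic.exists_within
  choose K₂ N₂ h₂ using fun i : Inv ar D => i.lhs.exists_within
  choose K₃ N₃ h₃ using fun i : Inv ar D => i.rhs.exists_within
  let K := hI.toFinset.biUnion fun i => K₁ i ∪ (K₂ i ∪ K₃ i)
  have hK : ∀ i ∈ I, i.ic.Within (K : Set D) (N₁ i + N₂ i + N₃ i) ∧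
      i.lhs.Within (K : Set D) (N₁ i + N₂ i + N₃ i) ∧
      i.rhs.Within (K : Set D) (N₁ i + N₂ i + N₃ i) := by
    intro i hi
    have hsub : K₁ i ∪ (K₂ i ∪ K₃ i) ⊆ K :=
      Finset.subset_biUnion_of_mem (fun i => K₁ i ∪ (K₂ i ∪ K₃ i)) (hI.mem_toFinset.2 hi)
    exact ⟨(h₁ i).mono (fun c hc => hsub (Finset.mem_union_left _ hc)) (by omega),
      (h₂ i).mono (fun c hc => hsub (Finset.mem_union_right _ (Finset.mem_union_left _ hc)))
        (by omega),
      (h₃ i).mono (fun c hc => hsub (Finset.mem_union_right _ (Finset.mem_union_right _ hc)))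
        (by omega)⟩
  refine ⟨K, fun φ e e' h => ?_⟩
  rcases h with h | ⟨χ, p, q, h, h' | h'⟩
  · exact ⟨_, hK _ h⟩
  · cases h'
    exact ⟨_, hK _ h⟩
  · cases h'
    obtain ⟨hφ, hp, hq⟩ := hK _ h
    exact ⟨_, hφ, hq, hp⟩

/-! ### Well-quasi-ordering of order types -/

theorem exists_strictMonoOn_of_map_eq {α β : Type*} [LinearOrder α] {l m : List α}
    {f g : α → β} (hl : l.SortedLT) (hm : m.SortedLT) (h : l.map f = m.map g) :
    ∃ ι : α → α, StrictMonoOn ι {x | x ∈ l} ∧ ∀ x ∈ l, g (ι x) = f x := by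
  have hlen : l.length = m.length := by simpa using congrArg List.length h
  have hidx : ∀ (i : ℕ) (hi : i < l.length), l.idxOf l[i] = i := fun i hi =>
    List.Nodup.idxOf_getElem hl.nodup i hi
  refine ⟨fun x => m.getD (l.idxOf x) x, ?_, ?_⟩
  · intro x hx y hy hxy
    obtain ⟨i, hi, rfl⟩ := List.getElem_of_mem hx
    obtain ⟨j, hj, rfl⟩ := List.getElem_of_mem hy
    have hij : i < j := by
      by_contra hji
      exact absurd hxy (not_lt.2 (hl.sortedLE.getElem_le_getElem_of_le (not_lt.1 hji)))
    simp only [hidx, List.getD_eq_getElem _ _ (hlen ▸ hi), List.getD_eq_getElem _ _ (hlen ▸ hj)]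
    exact hm.getElem_lt_getElem_of_lt hij
  · intro x hx
    obtain ⟨i, hi, rfl⟩ := List.getElem_of_mem hx
    simp only [hidx, List.getD_eq_getElem _ _ (hlen ▸ hi)]
    have := List.getElem_of_eq h (i := i) (by simpa using hi)
    simpa using this.symm

/-- Higman's lemma for assignments. Attach to the `n`-th assignment the increasing list of the
values it takes below `N n` or on `M`, together with the objects of `K`, each labelled by the
element of `K` and the variables of `M` that it represents. If one labelled list embeds in
another, the first assignment can be moved along the embedding so that it agrees with the second
one on `M`, without changing its order type over `K`. -/
theorem exists_lt_sameType [LinearOrder D] (K : Finset D) (M : Finset ℕ)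
    (θ : ℕ → Assignment D) (N : ℕ → ℕ) :
    ∃ m n, m < n ∧ ∃ θ' : Assignment D, SameType (K : Set D) (N m) (θ m) θ' ∧
      ∀ u ∈ M, θ' u = θ n u := by
  let A : ℕ → Finset D := fun n => (Finset.range (N n)).image (θ n) ∪ K ∪ M.image (θ n)
  let lab : ℕ → D → Set K × Set M := fun n x => ({c | c.1 = x}, {u | θ n u.1 = x})
  have hwqo := Set.PartiallyWellOrderedOn.partiallyWellOrderedOn_sublistForall₂
    (α := Set K × Set M) (· = ·) (Set.toFinite Set.univ).partiallyWellOrderedOn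
  obtain ⟨m, n, hmn, h⟩ := Set.partiallyWellOrderedOn_iff_exists_lt.1 hwqo
    (fun n => ((A n).sort (· ≤ ·)).map (lab n)) (fun _ _ _ => Set.mem_univ _)
  obtain ⟨l, hl, hsub⟩ := List.sublistForall₂_iff.1 h
  rw [List.forall₂_eq_eq_eq] at hl
  subst hl
  obtain ⟨l, hl, hmap⟩ := List.sublist_map_iff.1 hsub
  have hlt : l.SortedLT :=
    List.Pairwise.sortedLT (((A n).sortedLT_sort.pairwise).sublist hl)
  obtain ⟨ι, hι, hlab⟩ := exists_strictMonoOn_of_map_eq (A m).sortedLT_sort hlt hmap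
  have hmem : ∀ x ∈ A m, x ∈ (A m).sort := fun x hx => (Finset.mem_sort _).2 hx
  have hK : ∀ c ∈ K, c ∈ A m ∧ ι c = c := by
    intro c hc
    have hcA : c ∈ A m := Finset.mem_union_left _ (Finset.mem_union_right _ hc)
    have h₁ : (⟨c, hc⟩ : K) ∈ (lab n (ι c)).1 := by
      rw [hlab c (hmem c hcA)]
      rfl
    exact ⟨hcA, Eq.symm h₁⟩
  have hN : ∀ u < N m, θ m u ∈ A m := fun u hu => Finset.mem_union_left _
    (Finset.mem_union_left _ (Finset.mem_image_of_mem _ (Finset.mem_range.2 hu)))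
  have hlt_iff : ∀ x ∈ A m, ∀ y ∈ A m, x < y ↔ ι x < ι y := fun x hx y hy =>
    (hι.lt_iff_lt (hmem x hx) (hmem y hy)).symm
  refine ⟨m, n, hmn, fun u => ι (θ m u), ⟨fun u hu v hv => hlt_iff _ (hN u hu) _ (hN v hv),
    fun u hu c hc => ?_⟩, fun u hu => ?_⟩
  · obtain ⟨hcA, hcι⟩ := hK c hc
    have h₁ := hlt_iff _ (hN u hu) _ hcA
    have h₂ := hlt_iff _ hcA _ (hN u hu)
    rw [hcι] at h₁ h₂
    exact ⟨h₁, h₂⟩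
  · have huA : θ m u ∈ A m := Finset.mem_union_right _ (Finset.mem_image_of_mem _ hu)
    have h₁ : (⟨u, hu⟩ : M) ∈ (lab n (ι (θ m u))).2 := by
      rw [hlab _ (hmem _ huA)]
      rfl
    exact Eq.symm h₁

/-! ### Reachability between ground heads -/

/-- One ground inclusion demanded by `I`: some inclusion of `split I` has a ground instance with
true condition from `a` to `b`. -/
def Step [LinearOrder D] (I : Set (Inv ar D)) (a b : Σ f : F, (Fin (ar f) → D)) : Prop :=
  ∃ (φ : IC D) (e e' : Expr ar D), (⟨φ, e, .sub, e'⟩ : Inv ar D) ∈ split I ∧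
    ∃ θ : Assignment D, φ.Holds θ ∧ e.ground θ = a ∧ e'.ground θ = b

/-- Reachability by ground inclusions demanded by `I`. -/
abbrev Reach [LinearOrder D] (I : Set (Inv ar D)) :
    (Σ f : F, (Fin (ar f) → D)) → (Σ f : F, (Fin (ar f) → D)) → Prop :=
  Relation.ReflTransGen (Step I)

/-- If `I` entails an inclusion, each ground instance of it is a path: otherwise the state in which
an object is returned exactly by the code calls reachable from the left-hand side satisfies `I`
but not the inclusion. -/
theorem reach_of_entails [LinearOrder D] [Nonempty D] {I : Set (Inv ar D)} {φ : IC D}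
    {e e' : Expr ar D} (h : Entails I ⟨φ, e, .sub, e'⟩) {θ : Assignment D} (hθ : φ.Holds θ) :
    Reach I (e.ground θ) (e'.ground θ) := by
  obtain ⟨o⟩ := ‹Nonempty D›
  let S : State ar D := {g | Reach I (e.ground θ) ⟨g.name, g.args⟩}
  refine @h S (fun i hi η hη => ?_) θ hθ o Relation.ReflTransGen.refl
  obtain ⟨χ, p, r, q⟩ := i
  cases r with
  | sub => exact fun x hx => Relation.ReflTransGen.tail hx ⟨χ, p, q, Or.inl hi, η, hη, rfl, rfl⟩
  | eq =>
    have h₁ : p.den S η ⊆ q.den S η := fun x hx => Relation.ReflTransGen.tail hx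
      ⟨χ, p, q, Or.inr ⟨χ, p, q, hi, Or.inl rfl⟩, η, hη, rfl, rfl⟩
    have h₂ : q.den S η ⊆ p.den S η := fun x hx => Relation.ReflTransGen.tail hx
      ⟨χ, q, p, Or.inr ⟨χ, p, q, hi, Or.inr rfl⟩, η, hη, rfl, rfl⟩
    exact Set.Subset.antisymm h₁ h₂

/-! ### Derivable invariants -/

theorem split_mono {X Y : Set (Inv ar D)} (h : X ⊆ Y) : split X ⊆ split Y := by
  rintro i (hi | ⟨φ, e, e', hi, h'⟩)
  · exact Or.inl (h hi)
  · exact Or.inr ⟨φ, e, e', h hi, h'⟩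

section Derivable

variable [LinearOrder D] {simplify : IC D → IC D} {I : Set (Inv ar D)}

/-- The invariants available to the combination operations at some stage of the iteration. -/
def derivable (simplify : IC D → IC D) (I : Set (Inv ar D)) : Set (Inv ar D) :=
  {i | ∃ n, i ∈ split (power simplify I n ∪ I)}

theorem power_monotone : Monotone (power simplify I) :=
  monotone_nat_of_le_succ fun _ _ hi => Or.inr (Or.inr hi)

theorem stage_mono {m n : ℕ} (h : m ≤ n) :
    split (power simplify I m ∪ I) ⊆ split (power simplify I n ∪ I) :=
  split_mono (Set.union_subset_union_left _ (power_monotone h))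

theorem split_subset_derivable : split I ⊆ derivable simplify I :=
  fun _ hi => ⟨0, split_mono Set.subset_union_right hi⟩

theorem taut_subset_derivable : Taut ar D ⊆ derivable simplify I :=
  fun _ hi => ⟨0, Or.inl (Or.inl hi)⟩

theorem derivable_ff (e : Expr ar D) (r : Rel) (e' : Expr ar D) :
    (⟨.ff, e, r, e'⟩ : Inv ar D) ∈ derivable simplify I :=
  taut_subset_derivable fun _ _ h => h.elim

theorem derivable_of_mem_power {i : Inv ar D} {n : ℕ} (h : i ∈ power simplify I n) :
    i ∈ derivable simplify I := ⟨n, Or.inl (Or.inl h)⟩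

theorem exists_powerOmega_of_derivable {i : Inv ar D} (h : i ∈ derivable simplify I) :
    ∃ i' ∈ powerOmega simplify I, Entails {i'} i := by
  obtain ⟨n, hn⟩ := h
  have mem : ∀ j ∈ power simplify I n ∪ I, j ∈ powerOmega simplify I := by
    rintro j (hj | hj)
    · exact Set.mem_iUnion.2 ⟨n, hj⟩
    · exact Set.mem_iUnion.2 ⟨1, Or.inr (Or.inl hj)⟩
  rcases hn with hi | ⟨φ, e, e', hj, hi⟩
  · exact ⟨i, mem i hi, fun S hS => hS i rfl⟩
  · refine ⟨_, mem _ hj, fun S hS => ?_⟩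
    have hS' := hS _ rfl
    rcases hi with rfl | rfl
    · exact fun θ hθ => (show e.den S θ = e'.den S θ from hS' θ hθ).subset
    · exact fun θ hθ => (show e.den S θ = e'.den S θ from hS' θ hθ).symm.subset

/-- Transitivity by `Combine1`. When `Combine1` refuses its result because `ChkEnt` finds it
subsumed, the subsuming invariant serves instead. -/
theorem derivable_trans_of_implies (hs : IsSimplify simplify) {φ₁ φ₂ : IC D}
    {e₁ e₁' e₂ e₂' : Expr ar D}
    (h₁ : (⟨φ₁, e₁, .sub, e₁'⟩ : Inv ar D) ∈ derivable simplify I)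
    (h₂ : (⟨φ₂, e₂, .sub, e₂'⟩ : Inv ar D) ∈ derivable simplify I)
    (h : e₁'.Implies e₂) {θ : Assignment D} (hθ₁ : φ₁.Holds θ) (hθ₂ : φ₂.Holds θ) :
    ∃ (ψ : IC D) (p q : Expr ar D), (⟨ψ, p, .sub, q⟩ : Inv ar D) ∈ derivable simplify I ∧
      (∀ θ, φ₁.Holds θ → φ₂.Holds θ → ψ.Holds θ) ∧ e₁.Implies p ∧ q.Implies e₂' := by
  obtain ⟨m, hm⟩ := h₁
  obtain ⟨n, hn⟩ := h₂
  replace hm := stage_mono (le_max_left m n) hm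
  replace hn := stage_mono (le_max_right m n) hn
  generalize max m n = k at hm hn
  have hand := (hs (.and φ₁ φ₂)).2.2
  have hff : simplify (.and φ₁ φ₂) ≠ .ff := by
    intro hff
    have := (hand θ).2 ⟨hθ₁, hθ₂⟩
    rw [hff] at this
    exact this
  have hrel : derivedRel (split (power simplify I k ∪ I)) ⟨φ₁, e₁, .sub, e₁'⟩
      ⟨φ₂, e₂, .sub, e₂'⟩ = .sub := if_neg fun h => Rel.noConfusion h.1
  by_cases hj : ∃ j ∈ split (power simplify I k ∪ I),
      ChkEnt j ⟨simplify (.and φ₁ φ₂), e₁, .sub, e₂'⟩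
  · obtain ⟨⟨ψ, p, r, q⟩, hj, himp, -, hp, hq⟩ := hj
    refine ⟨ψ, p, q, ⟨k, ?_⟩, fun θ h₁ h₂ => himp θ ((hand θ).2 ⟨h₁, h₂⟩), hp, hq⟩
    cases r with
    | sub => exact hj
    | eq =>
      rcases hj with hj | ⟨_, _, _, _, hj | hj⟩
      · exact Or.inr ⟨ψ, p, q, hj, Or.inl rfl⟩
      · cases hj
      · cases hj
  · refine ⟨_, e₁, e₂', derivable_of_mem_power (n := k + 1) (Or.inl (Or.inl (Or.inl
      ⟨_, hm, _, hn, Or.inl h, hff, ?_, hj⟩))), fun θ h₁ h₂ => (hand θ).2 ⟨h₁, h₂⟩,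
      e₁.implies_refl, e₂'.implies_refl⟩
    rw [hrel]

/-- Disjunction by `Combine3`, up to most general unifiers chosen for the two pairs of sides. -/
theorem derivable_or_of_isMGU (hs : IsSimplify simplify) {φ₁ φ₂ : IC D}
    {e₁ e₁' e₂ e₂' : Expr ar D}
    (h₁ : (⟨φ₁, e₁, .sub, e₁'⟩ : Inv ar D) ∈ derivable simplify I)
    (h₂ : (⟨φ₂, e₂, .sub, e₂'⟩ : Inv ar D) ∈ derivable simplify I) {σ γ : Subst D}
    (hσ : IsMGU σ e₁ e₂) (hγ : IsMGU γ (e₁'.subst σ) (e₂'.subst σ)) :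
    ∃ ψ : IC D, (⟨ψ, (e₁.subst σ).subst γ, .sub, (e₁'.subst σ).subst γ⟩ : Inv ar D) ∈
      derivable simplify I ∧ ∀ θ, ψ.Holds θ ↔ (((IC.or φ₁ φ₂).subst σ).subst γ).Holds θ := by
  obtain ⟨m, hm⟩ := h₁
  obtain ⟨n, hn⟩ := h₂
  replace hm := stage_mono (le_max_left m n) hm
  replace hn := stage_mono (le_max_right m n) hn
  exact ⟨_, derivable_of_mem_power (n := max m n + 1) (Or.inl (Or.inr
    ⟨_, hm, _, hn, rfl, σ, γ, hσ, hγ, rfl⟩)), (hs _).2.2⟩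

theorem derivable_or (hs : IsSimplify simplify) {φ₁ φ₂ : IC D} {e e' : Expr ar D}
    (h₁ : (⟨φ₁, e, .sub, e'⟩ : Inv ar D) ∈ derivable simplify I)
    (h₂ : (⟨φ₂, e, .sub, e'⟩ : Inv ar D) ∈ derivable simplify I) :
    ∃ ψ : IC D, (⟨ψ, e, .sub, e'⟩ : Inv ar D) ∈ derivable simplify I ∧
      ∀ θ, ψ.Holds θ ↔ φ₁.Holds θ ∨ φ₂.Holds θ := by
  obtain ⟨ψ, hψ, h⟩ := derivable_or_of_isMGU hs h₁ h₂ (isMGU_var e) (isMGU_var _)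
  rw [Expr.subst_var, Expr.subst_var, Expr.subst_var, Expr.subst_var] at hψ
  rw [IC.subst_var, IC.subst_var] at h
  exact ⟨ψ, hψ, h⟩

/-- Renaming of variables: `Combine3` of an invariant with itself, for an injective renaming as
most general unifier. -/
theorem derivable_rename (hs : IsSimplify simplify) {φ : IC D} {e e' : Expr ar D}
    (h : (⟨φ, e, .sub, e'⟩ : Inv ar D) ∈ derivable simplify I) {π : ℕ → ℕ}
    (hπ : π.Injective) :
    ∃ ψ : IC D, (⟨ψ, e.subst fun v => .var (π v), .sub, e'.subst fun v => .var (π v)⟩ :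
      Inv ar D) ∈ derivable simplify I ∧ ∀ θ, ψ.Holds θ ↔ φ.Holds (θ ∘ π) := by
  obtain ⟨ψ, hψ, h⟩ := derivable_or_of_isMGU hs h h (isMGU_rename hπ e) (isMGU_var _)
  rw [Expr.subst_var, Expr.subst_var] at hψ
  refine ⟨ψ, hψ, fun θ => ?_⟩
  rw [h, IC.subst_var, IC.holds_rename]
  exact or_self_iff

/-- Two opposite inclusions give an equality by `Combine2`. -/
theorem derivable_eq (hs : IsSimplify simplify) {φ₁ φ₂ : IC D} {e e' : Expr ar D}
    (h₁ : (⟨φ₁, e, .sub, e'⟩ : Inv ar D) ∈ derivable simplify I)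
    (h₂ : (⟨φ₂, e', .sub, e⟩ : Inv ar D) ∈ derivable simplify I) :
    ∃ ψ : IC D, (⟨ψ, e, .eq, e'⟩ : Inv ar D) ∈ derivable simplify I ∧
      ∀ θ, ψ.Holds θ ↔ φ₁.Holds θ ∧ φ₂.Holds θ := by
  have hand := (hs (.and φ₁ φ₂)).2.2
  by_cases hff : simplify (.and φ₁ φ₂) = .ff
  · refine ⟨.ff, derivable_ff _ _ _, fun θ => ?_⟩
    rw [← hff]
    exact hand θ
  obtain ⟨m, hm⟩ := h₁
  obtain ⟨n, hn⟩ := h₂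
  replace hm := stage_mono (le_max_left m n) hm
  replace hn := stage_mono (le_max_right m n) hn
  refine ⟨_, derivable_of_mem_power (n := max m n + 1) (Or.inl (Or.inl (Or.inr
    ⟨_, hm, _, hn, rfl, rfl, Term.var, Term.var, isMGU_var _, isMGU_var _, ?_, ?_⟩))), hand⟩
  · rw [IC.subst_var, IC.subst_var]
    exact hff
  · simp only [IC.subst_var, Expr.subst_var]

theorem exists_derivable_of_ground_eq {e e' : Expr ar D} (h : e.name = e'.name) :
    ∃ ψ : IC D, (⟨ψ, e, .sub, e'⟩ : Inv ar D) ∈ derivable simplify I ∧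
      ∀ θ, e.ground θ = e'.ground θ → ψ.Holds θ := by
  obtain ⟨ψ, hψ⟩ := exists_ic_ground_eq h
  exact ⟨ψ, taut_subset_derivable fun S θ hθ => (Expr.den_congr S ((hψ θ).1 hθ)).subset,
    fun θ => (hψ θ).2⟩

end Derivable

/-! ### Domains with one object -/

theorem Expr.ground_eq_of_name_eq [Subsingleton D] {e e' : Expr ar D} (h : e.name = e'.name)
    (θ θ' : Assignment D) : e.ground θ = e'.ground θ' := by
  obtain ⟨f, s⟩ := e
  obtain ⟨g, t⟩ := e'
  obtain rfl : f = g := h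
  exact congrArg (Sigma.mk f) (Subsingleton.elim _ _)

theorem Expr.implies_of_name_eq [Subsingleton D] {e e' : Expr ar D} (h : e.name = e'.name) :
    e.Implies e' :=
  fun S θ => (Expr.den_congr S (Expr.ground_eq_of_name_eq h θ θ)).subset

section Subsingleton

variable [LinearOrder D] {simplify : IC D → IC D} {I : Set (Inv ar D)}

theorem exists_derivable_of_reach_subsingleton [Subsingleton D] (hs : IsSimplify simplify)
    (c : D) {a b : Σ f : F, (Fin (ar f) → D)} (h : Reach I a b) :
    ∃ (ψ : IC D) (p q : Expr ar D), (⟨ψ, p, .sub, q⟩ : Inv ar D) ∈ derivable simplify I ∧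
      (∀ θ, ψ.Holds θ) ∧ p.name = a.1 ∧ q.name = b.1 := by
  have : Nonempty D := ⟨c⟩
  induction h with
  | refl =>
    exact ⟨.tt, constExpr ar c a.1, constExpr ar c a.1,
      taut_subset_derivable fun _ _ _ => subset_rfl, fun _ => trivial, rfl, rfl⟩
  | tail _ hstep ih =>
    obtain ⟨ψ, p, q, hd, hψ, hp, hq⟩ := ih
    obtain ⟨φ, e, e', he, θ, hφ, h₁, h₂⟩ := hstep
    obtain ⟨χ, p', q', hd', hχ, hp', hq'⟩ := derivable_trans_of_implies hs hd
      (split_subset_derivable he)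
      (Expr.implies_of_name_eq (hq.trans (congrArg Sigma.fst h₁).symm)) (hψ θ) hφ
    refine ⟨χ, p', q', hd', fun η => ?_, ?_, ?_⟩
    · obtain rfl : θ = η := Subsingleton.elim _ _
      exact hχ θ (hψ θ) hφ
    · exact (Expr.name_eq_of_ground_eq (Expr.ground_eq_of_implies hp' θ)).symm.trans hp
    · exact (Expr.name_eq_of_ground_eq (Expr.ground_eq_of_implies hq' θ)).trans
        (congrArg Sigma.fst h₂)

/-- `Combine3` with the tautology whose condition is `false` turns a derived inclusion into one
between the expressions `f(c,…,c)` and `g(c,…,c)`, so that opposite inclusions become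
unifiable. -/
theorem exists_derivable_constExpr [Subsingleton D] (hs : IsSimplify simplify) (c : D)
    (f g : F) : ∃ ψ : IC D,
      (⟨ψ, constExpr ar c f, .sub, constExpr ar c g⟩ : Inv ar D) ∈ derivable simplify I ∧
      ∀ a b θ, Reach I ⟨f, a⟩ ⟨g, b⟩ → ψ.Holds θ := by
  by_cases h : Reach I ⟨f, fun _ => c⟩ ⟨g, fun _ => c⟩
  · obtain ⟨ψ, p, q, hd, hψ, rfl, rfl⟩ := exists_derivable_of_reach_subsingleton hs c h
    obtain ⟨σ, hσ, hσp⟩ := exists_isMGU_constExpr c p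
    obtain ⟨γ, hγ, hγq⟩ := exists_isMGU_constExpr c (q.subst σ)
    obtain ⟨χ, hχ, hχψ⟩ := derivable_or_of_isMGU hs hd
      (derivable_ff (constExpr ar c p.name) _ (constExpr ar c q.name)) hσ hγ
    rw [hσp, hγq] at hχ
    refine ⟨χ, hχ, fun _ _ θ _ => (hχψ θ).2 (Or.inl ?_)⟩
    have key : ∀ (ψ : IC D) (σ : Subst D), (∀ θ, ψ.Holds θ) → ∀ θ, (ψ.subst σ).Holds θ := by
      intro ψ σ h θ
      have heval : ∀ t : Term D, (t.subst σ).eval θ = t.eval θ :=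
        fun t => Subsingleton.elim _ _
      have : (ψ.subst σ).Holds θ ↔ ψ.Holds θ := by
        clear h
        induction ψ <;> simp_all [IC.subst, IC.Holds]
      exact this.2 (h θ)
    exact key _ _ (key _ _ hψ) θ
  · refine ⟨.ff, derivable_ff _ _ _, fun a b _ hab => h ?_⟩
    rw [Subsingleton.elim a fun _ => c, Subsingleton.elim b fun _ => c] at hab
    exact hab

end Subsingleton

/-! ### Domains with several objects -/

/-- The expression `f(x₂, x₆, x₁₀, …)`. -/
def lhsExpr (ar : F → ℕ) (D : Type*) (f : F) : Expr ar D := ⟨f, fun i => .var (4 * i + 2)⟩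

/-- The expression `f(x₃, x₇, x₁₁, …)`. -/
def rhsExpr (ar : F → ℕ) (D : Type*) (f : F) : Expr ar D := ⟨f, fun i => .var (4 * i + 3)⟩

/-- The residues modulo 4 give room for two renamed-apart copies of all variables and for the
arguments of `lhsExpr` and `rhsExpr`. -/
theorem exists_glue (θ₁ θ₂ : Assignment D) (a b : Σ f : F, (Fin (ar f) → D)) :
    ∃ θ : Assignment D, (θ ∘ fun v => 4 * v) = θ₁ ∧ (θ ∘ fun v => 4 * v + 1) = θ₂ ∧
      (lhsExpr ar D a.1).ground θ = a ∧ (rhsExpr ar D b.1).ground θ = b := by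
  let θ : Assignment D := fun v =>
    if v % 4 = 0 then θ₁ (v / 4) else if v % 4 = 1 then θ₂ (v / 4)
    else if v % 4 = 2 then (if h : v / 4 < ar a.1 then a.2 ⟨v / 4, h⟩ else θ₁ 0)
    else (if h : v / 4 < ar b.1 then b.2 ⟨v / 4, h⟩ else θ₁ 0)
  have h₀ : ∀ v, θ (4 * v) = θ₁ v := fun v => by
    have h₁ : 4 * v % 4 = 0 := by omega
    have h₂ : 4 * v / 4 = v := by omega
    simp only [θ, h₁, h₂, if_true]
  have h₁ : ∀ v, θ (4 * v + 1) = θ₂ v := fun v => by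
    have h₁ : (4 * v + 1) % 4 = 1 := by omega
    have h₂ : (4 * v + 1) / 4 = v := by omega
    simp [θ, h₁, h₂]
  have h₂ : ∀ i : Fin (ar a.1), θ (4 * i + 2) = a.2 i := fun i => by
    have h₁ : (4 * (i : ℕ) + 2) % 4 = 2 := by omega
    have h₂ : (4 * (i : ℕ) + 2) / 4 = i := by omega
    simp [θ, h₁, h₂]
  have h₃ : ∀ i : Fin (ar b.1), θ (4 * i + 3) = b.2 i := fun i => by
    have h₁ : (4 * (i : ℕ) + 3) % 4 = 3 := by omega
    have h₂ : (4 * (i : ℕ) + 3) / 4 = i := by omega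
    simp [θ, h₁, h₂]
  exact ⟨θ, funext h₀, funext h₁, congrArg (Sigma.mk a.1) (funext h₂),
    congrArg (Sigma.mk b.1) (funext h₃)⟩

section Nontrivial

variable [LinearOrder D] [Nontrivial D] {simplify : IC D → IC D} {I : Set (Inv ar D)}

theorem derivable_trans (hs : IsSimplify simplify) {φ₁ φ₂ : IC D} {e₁ e₂ e₃ : Expr ar D}
    (h₁ : (⟨φ₁, e₁, .sub, e₂⟩ : Inv ar D) ∈ derivable simplify I)
    (h₂ : (⟨φ₂, e₂, .sub, e₃⟩ : Inv ar D) ∈ derivable simplify I) :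
    ∃ ψ : IC D, (⟨ψ, e₁, .sub, e₃⟩ : Inv ar D) ∈ derivable simplify I ∧
      ∀ θ, φ₁.Holds θ → φ₂.Holds θ → ψ.Holds θ := by
  by_cases h : ∃ θ, φ₁.Holds θ ∧ φ₂.Holds θ
  · obtain ⟨θ, hθ₁, hθ₂⟩ := h
    obtain ⟨ψ, p, q, hd, hψ, hp, hq⟩ :=
      derivable_trans_of_implies hs h₁ h₂ e₂.implies_refl hθ₁ hθ₂
    rw [← Expr.eq_of_implies hp, Expr.eq_of_implies hq] at hd
    exact ⟨ψ, hd, hψ⟩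
  · exact ⟨.ff, derivable_ff _ _ _, fun θ hθ₁ hθ₂ => h ⟨θ, hθ₁, hθ₂⟩⟩

/-- The two sides of a derived inclusion can be replaced by any expressions with the same names,
at the price of equating the arguments in the condition. -/
theorem derivable_transport (hs : IsSimplify simplify) {φ : IC D} {e e' t t' : Expr ar D}
    (h : (⟨φ, e, .sub, e'⟩ : Inv ar D) ∈ derivable simplify I) (ht : t.name = e.name)
    (ht' : e'.name = t'.name) :
    ∃ ψ : IC D, (⟨ψ, t, .sub, t'⟩ : Inv ar D) ∈ derivable simplify I ∧
      ∀ θ, φ.Holds θ → t.ground θ = e.ground θ → e'.ground θ = t'.ground θ → ψ.Holds θ := by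
  obtain ⟨χ₁, h₁, hχ₁⟩ := exists_derivable_of_ground_eq (simplify := simplify) (I := I) ht
  obtain ⟨χ₂, h₂, hχ₂⟩ := exists_derivable_of_ground_eq (simplify := simplify) (I := I) ht'
  obtain ⟨χ, h₃, hχ⟩ := derivable_trans hs h₁ h
  obtain ⟨ψ, h₄, hψ⟩ := derivable_trans hs h₃ h₂
  exact ⟨ψ, h₄, fun θ hφ ht ht' => hψ θ (hχ θ (hχ₁ θ ht) hφ) (hχ₂ θ ht')⟩

/-- Each path is an instance of a derived inclusion. The assignment `θ` witnessing this may be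
replaced by any other one with the same order type over the constants of `I`, although `simplify`
and `ChkEnt` may bring further constants into the condition. -/
theorem exists_derivable_of_reach (hs : IsSimplify simplify) {K : Set D}
    (hK : ∀ φ e e', (⟨φ, e, .sub, e'⟩ : Inv ar D) ∈ split I →
      ∃ N, φ.Within K N ∧ e.Within K N ∧ e'.Within K N)
    {a b : Σ f : F, (Fin (ar f) → D)} (h : Reach I a b) :
    ∃ (ψ : IC D) (θ : Assignment D) (N : ℕ),
      (⟨ψ, lhsExpr ar D a.1, .sub, rhsExpr ar D b.1⟩ : Inv ar D) ∈ derivable simplify I ∧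
      (∀ θ', SameType K N θ θ' → ψ.Holds θ') ∧
      (lhsExpr ar D a.1).ground θ = a ∧ (rhsExpr ar D b.1).ground θ = b := by
  have hwl : ∀ (f : F) (N : ℕ), 4 * ar f + 4 ≤ N → (lhsExpr ar D f).Within K N :=
    fun f N hN i => by
      have := i.2
      change 4 * (i : ℕ) + 2 < N
      change (i : ℕ) < ar f at this
      omega
  have hwr : ∀ (f : F) (N : ℕ), 4 * ar f + 4 ≤ N → (rhsExpr ar D f).Within K N :=
    fun f N hN i => by
      have := i.2
      change 4 * (i : ℕ) + 3 < N
      change (i : ℕ) < ar f at this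
      omega
  induction h with
  | refl =>
    obtain ⟨ψ, hψ, hψ'⟩ := exists_derivable_of_ground_eq (simplify := simplify) (I := I)
      (show (lhsExpr ar D a.1).name = (rhsExpr ar D a.1).name from rfl)
    obtain ⟨θ, -, -, hl, hr⟩ := exists_glue (fun _ => Classical.arbitrary D)
      (fun _ => Classical.arbitrary D) a a
    exact ⟨ψ, θ, 4 * ar a.1 + 4, hψ, fun θ' hθ' => hψ' θ' (hθ'.ground_eq (hwl _ _ le_rfl)
      (hwr _ _ le_rfl) (hl.trans hr.symm)), hl, hr⟩
  | @tail b c _ hstep ih =>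
    obtain ⟨ψ, θ₁, N₁, hd₁, hψ, hl₁, hr₁⟩ := ih
    obtain ⟨φ, e, e', hd₂, θ₂, hφ, he, he'⟩ := hstep
    obtain ⟨N₂, hw, hwe, hwe'⟩ := hK _ _ _ hd₂
    obtain ⟨ψ₁, h₁, hψ₁⟩ := derivable_rename hs hd₁ (π := fun v => 4 * v)
      (fun u v huv => by simpa using huv)
    obtain ⟨ψ₂, h₂, hψ₂⟩ := derivable_rename hs
      (split_subset_derivable (simplify := simplify) hd₂) (π := fun v => 4 * v + 1)
      (fun u v huv => by simpa using huv)
    obtain ⟨χ₁, h₃, hχ₁⟩ := derivable_transport hs h₁ (t := lhsExpr ar D a.1)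
      (t' := e.subst fun v => .var (4 * v + 1)) rfl (congrArg Sigma.fst he).symm
    obtain ⟨χ₂, h₄, hχ₂⟩ := derivable_transport hs h₂ (t := e.subst fun v => .var (4 * v + 1))
      (t' := rhsExpr ar D c.1) rfl (congrArg Sigma.fst he')
    obtain ⟨χ, h₅, hχ⟩ := derivable_trans hs h₃ h₄
    obtain ⟨θ, hθ₁, hθ₂, hl, hr⟩ := exists_glue θ₁ θ₂ a c
    -- Large enough for the renamed variables of both conditions and for all argument variables.
    let N := 16 * (N₁ + N₂ + ar a.1 + ar b.1 + ar c.1 + 4)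
    have hren : ∀ (p : Expr ar D) (π : ℕ → ℕ) (M : ℕ), p.Within K M → (∀ v < M, π v < N) →
        (p.subst fun v => .var (π v)).Within K N := by
      intro p π M hp hπ i
      have hi := hp i
      change ((p.args i).subst _).Within K N
      cases hpi : p.args i with
      | const d => rw [hpi] at hi; exact hi
      | var v => rw [hpi] at hi; exact hπ v hi
    refine ⟨χ, θ, N, h₅, fun θ' hθ' => hχ θ' (hχ₁ θ' ?_ ?_ ?_) (hχ₂ θ' ?_ rfl ?_), hl, hr⟩
    · rw [hψ₁]
      refine hψ _ ?_
      rw [← hθ₁]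
      exact hθ'.comp _ fun v hv => by simp only [N]; omega
    · refine hθ'.ground_eq (hwl _ _ (by simp only [N]; omega))
        (hren _ (fun v => 4 * v) (4 * ar a.1 + 4) (hwl _ _ le_rfl)
          fun v hv => by simp only [N]; omega) ?_
      rw [Expr.ground_rename, hl, hθ₁, hl₁]
    · refine hθ'.ground_eq (hren _ (fun v => 4 * v) (4 * ar b.1 + 4) (hwr _ _ le_rfl)
          fun v hv => by simp only [N]; omega)
        (hren _ (fun v => 4 * v + 1) N₂ hwe fun v hv => by simp only [N]; omega) ?_
      rw [Expr.ground_rename, Expr.ground_rename, hθ₁, hθ₂, hr₁, he]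
    · rw [hψ₂]
      refine ((hθ'.comp (N' := N₂) (fun v => 4 * v + 1) fun v hv => by
        simp only [N]; omega).holds hw).1 ?_
      rw [hθ₂]
      exact hφ
    · refine hθ'.ground_eq (hren _ (fun v => 4 * v + 1) N₂ hwe' fun v hv => by
        simp only [N]; omega) (hwr _ _ (by simp only [N]; omega)) ?_
      rw [Expr.ground_rename, hθ₂, hr, he']

/-- A single derived inclusion between `f` and `g` covers all paths between them: by Higman's
lemma finitely many of the inclusions derived for the individual paths cover all paths, and
`Combine3` forms their disjunction. -/
theorem exists_derivable_cover (hs : IsSimplify simplify) (hI : I.Finite) (f g : F) :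
    ∃ ψ : IC D,
      (⟨ψ, lhsExpr ar D f, .sub, rhsExpr ar D g⟩ : Inv ar D) ∈ derivable simplify I ∧
      ∀ a b, Reach I ⟨f, a⟩ ⟨g, b⟩ → ∃ θ, ψ.Holds θ ∧
        (lhsExpr ar D f).ground θ = ⟨f, a⟩ ∧ (rhsExpr ar D g).ground θ = ⟨g, b⟩ := by
  classical
  obtain ⟨K, hK⟩ := exists_finset_within hI
  let P : IC D × Assignment D × ℕ → Prop := fun x =>
    (⟨x.1, lhsExpr ar D f, .sub, rhsExpr ar D g⟩ : Inv ar D) ∈ derivable simplify I ∧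
    ∀ θ', SameType (K : Set D) x.2.2 x.2.1 θ' → x.1.Holds θ'
  let covers : IC D → Assignment D → Prop := fun ψ η => ∃ θ, ψ.Holds θ ∧
    (lhsExpr ar D f).ground θ = (lhsExpr ar D f).ground η ∧
    (rhsExpr ar D g).ground θ = (rhsExpr ar D g).ground η
  have hfin : ∃ s : Finset (IC D × Assignment D × ℕ), (∀ x ∈ s, P x) ∧
      ∀ y, P y → ∃ x ∈ s, covers x.1 y.2.1 := by
    by_contra! hcon
    obtain ⟨x, hx, hbad⟩ := exists_seq_of_forall_finset_exists P
      (fun x y => ¬ covers x.1 y.2.1) hcon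
    let M := (Finset.range (ar f)).image (fun i => 4 * i + 2) ∪
      (Finset.range (ar g)).image (fun i => 4 * i + 3)
    obtain ⟨m, n, hmn, θ', hθ', hM⟩ :=
      exists_lt_sameType K M (fun n => (x n).2.1) (fun n => (x n).2.2)
    refine hbad m n hmn ⟨θ', (hx m).2 θ' hθ', ?_, ?_⟩
    · exact congrArg (Sigma.mk f) (funext fun i => hM _ (Finset.mem_union_left _
        (Finset.mem_image_of_mem _ (Finset.mem_range.2 i.2))))
    · exact congrArg (Sigma.mk g) (funext fun i => hM _ (Finset.mem_union_right _
        (Finset.mem_image_of_mem _ (Finset.mem_range.2 i.2))))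
  obtain ⟨s, hsP, hcov⟩ := hfin
  have hor : ∀ s : Finset (IC D × Assignment D × ℕ), (∀ x ∈ s, P x) → ∃ ψ : IC D,
      (⟨ψ, lhsExpr ar D f, .sub, rhsExpr ar D g⟩ : Inv ar D) ∈ derivable simplify I ∧
      ∀ x ∈ s, ∀ θ, x.1.Holds θ → ψ.Holds θ := by
    intro s
    induction s using Finset.induction_on with
    | empty => exact fun _ => ⟨.ff, derivable_ff _ _ _, by simp⟩
    | insert x s _ ih =>
      intro h
      obtain ⟨ψ, hψ, hψs⟩ := ih fun y hy => h y (Finset.mem_insert_of_mem hy)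
      obtain ⟨χ, hχ, hχψ⟩ := derivable_or hs (h x (Finset.mem_insert_self x s)).1 hψ
      refine ⟨χ, hχ, fun y hy θ hθ => (hχψ θ).2 ?_⟩
      rcases Finset.mem_insert.1 hy with rfl | hy
      · exact Or.inl hθ
      · exact Or.inr (hψs y hy θ hθ)
  obtain ⟨ψ, hψ, hψs⟩ := hor s hsP
  refine ⟨ψ, hψ, fun a b hab => ?_⟩
  obtain ⟨χ, η, N, hχ, hη, hl, hr⟩ := exists_derivable_of_reach hs hK hab
  obtain ⟨x, hx, θ, hθ, hθl, hθr⟩ := hcov (χ, η, N) ⟨hχ, hη⟩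
  exact ⟨θ, hψs x hx θ hθ, hθl.trans hl, hθr.trans hr⟩

end Nontrivial

/-! ### Completeness -/

/-- Opposite inclusions between the same two expressions that cover all paths between `f` and `g`,
in both directions by a common assignment. -/
theorem exists_derivable_pair [LinearOrder D] [Nonempty D] {simplify : IC D → IC D}
    {I : Set (Inv ar D)} (hs : IsSimplify simplify) (hI : I.Finite) (f g : F) :
    ∃ (t t' : Expr ar D) (ψ ψ' : IC D),
      (⟨ψ, t, .sub, t'⟩ : Inv ar D) ∈ derivable simplify I ∧
      (⟨ψ', t', .sub, t⟩ : Inv ar D) ∈ derivable simplify I ∧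
      ∀ a b, ∃ θ, t.ground θ = ⟨f, a⟩ ∧ t'.ground θ = ⟨g, b⟩ ∧
        (Reach I ⟨f, a⟩ ⟨g, b⟩ → ψ.Holds θ) ∧ (Reach I ⟨g, b⟩ ⟨f, a⟩ → ψ'.Holds θ) := by
  obtain ⟨c⟩ := ‹Nonempty D›
  rcases subsingleton_or_nontrivial D with hD | hD
  · obtain ⟨ψ, h, hψ⟩ := exists_derivable_constExpr (I := I) hs c f g
    obtain ⟨ψ', h', hψ'⟩ := exists_derivable_constExpr (I := I) hs c g f
    exact ⟨_, _, ψ, ψ', h, h', fun a b => ⟨fun _ => c,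
      congrArg (Sigma.mk f) (Subsingleton.elim _ _),
      congrArg (Sigma.mk g) (Subsingleton.elim _ _), hψ a b _, hψ' b a _⟩⟩
  · obtain ⟨ψ₁, h₁, hψ₁⟩ := exists_derivable_cover hs hI f g
    obtain ⟨ψ₂, h₂, hψ₂⟩ := exists_derivable_cover hs hI g f
    -- The two conditions must not share variables beyond the arguments of the new sides.
    obtain ⟨χ₁, h₃, hχ₁⟩ := derivable_rename hs h₁ (π := fun v => 4 * v)
      (fun u v huv => by simpa using huv)
    obtain ⟨χ₂, h₄, hχ₂⟩ := derivable_rename hs h₂ (π := fun v => 4 * v + 1)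
      (fun u v huv => by simpa using huv)
    obtain ⟨ψ, h, hψ⟩ := derivable_transport hs h₃ (t := lhsExpr ar D f)
      (t' := rhsExpr ar D g) rfl rfl
    obtain ⟨ψ', h', hψ'⟩ := derivable_transport hs h₄ (t := rhsExpr ar D g)
      (t' := lhsExpr ar D f) rfl rfl
    refine ⟨_, _, ψ, ψ', h, h', fun a b => ?_⟩
    have h₁' : ∃ θ₁ : Assignment D, Reach I ⟨f, a⟩ ⟨g, b⟩ → ψ₁.Holds θ₁ ∧
        (lhsExpr ar D f).ground θ₁ = ⟨f, a⟩ ∧ (rhsExpr ar D g).ground θ₁ = ⟨g, b⟩ := by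
      by_cases hab : Reach I ⟨f, a⟩ ⟨g, b⟩
      · obtain ⟨θ, hθ⟩ := hψ₁ a b hab
        exact ⟨θ, fun _ => hθ⟩
      · exact ⟨fun _ => c, fun h => absurd h hab⟩
    have h₂' : ∃ θ₂ : Assignment D, Reach I ⟨g, b⟩ ⟨f, a⟩ → ψ₂.Holds θ₂ ∧
        (lhsExpr ar D g).ground θ₂ = ⟨g, b⟩ ∧ (rhsExpr ar D f).ground θ₂ = ⟨f, a⟩ := by
      by_cases hab : Reach I ⟨g, b⟩ ⟨f, a⟩
      · obtain ⟨θ, hθ⟩ := hψ₂ b a hab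
        exact ⟨θ, fun _ => hθ⟩
      · exact ⟨fun _ => c, fun h => absurd h hab⟩
    obtain ⟨θ₁, hθ₁⟩ := h₁'
    obtain ⟨θ₂, hθ₂⟩ := h₂'
    obtain ⟨θ, hπ₁, hπ₂, hl, hr⟩ := exists_glue (ar := ar) θ₁ θ₂ ⟨f, a⟩ ⟨g, b⟩
    refine ⟨θ, hl, hr, fun hab => ?_, fun hba => ?_⟩
    · obtain ⟨hh, ha, hb⟩ := hθ₁ hab
      refine hψ θ ((hχ₁ θ).2 (hπ₁ ▸ hh)) ?_ ?_
      · rw [Expr.ground_rename, hπ₁, ha, hl]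
      · rw [Expr.ground_rename, hπ₁, hb, hr]
    · obtain ⟨hh, hb, ha⟩ := hθ₂ hba
      refine hψ' θ ((hχ₂ θ).2 (hπ₂ ▸ hh)) ?_ ?_
      · rw [Expr.ground_rename, hπ₂, hb, hr]
      · rw [Expr.ground_rename, hπ₂, ha, hl]

theorem exists_derivable_entails [LinearOrder D] [Nonempty D] {simplify : IC D → IC D}
    {I : Set (Inv ar D)} (hs : IsSimplify simplify) (hI : I.Finite) {inv : Inv ar D}
    (h : Entails I inv) : ∃ i ∈ derivable simplify I, Entails {i} inv := by
  obtain ⟨φ, e, r, e'⟩ := inv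
  obtain ⟨t, t', ψ, ψ', hd, hd', hcov⟩ := exists_derivable_pair hs hI e.name e'.name
  cases r with
  | sub =>
    refine ⟨_, hd, fun S hS θ hθ => ?_⟩
    obtain ⟨η, hη, hη', hψ, -⟩ := hcov (e.ground θ).2 (e'.ground θ).2
    have hsub : t.den S η ⊆ t'.den S η := hS _ rfl η (hψ (reach_of_entails h hθ))
    rw [Expr.den_congr S (hη : _ = e.ground θ), Expr.den_congr S (hη' : _ = e'.ground θ)] at hsub
    exact hsub
  | eq =>
    have h₁ : Entails I ⟨φ, e, .sub, e'⟩ := fun S hS θ hθ =>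
      (show e.den S θ = e'.den S θ from h S hS θ hθ).subset
    have h₂ : Entails I ⟨φ, e', .sub, e⟩ := fun S hS θ hθ =>
      (show e.den S θ = e'.den S θ from h S hS θ hθ).symm.subset
    obtain ⟨χ, hχ, hχψ⟩ := derivable_eq hs hd hd'
    refine ⟨_, hχ, fun S hS θ hθ => ?_⟩
    obtain ⟨η, hη, hη', hψ, hψ'⟩ := hcov (e.ground θ).2 (e'.ground θ).2
    have heq : t.den S η = t'.den S η := hS _ rfl η
      ((hχψ η).2 ⟨hψ (reach_of_entails h₁ hθ), hψ' (reach_of_entails h₂ hθ)⟩)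
    rw [Expr.den_congr S (hη : _ = e.ground θ), Expr.den_congr S (hη' : _ = e'.ground θ)] at heq
    exact heq

end CodeCallInv

theorem mainTheorem2 {F D : Type*} [LinearOrder D] [Nonempty D] (ar : F → ℕ)
    (simplify : CodeCallInv.IC D → CodeCallInv.IC D) (hsimp : CodeCallInv.IsSimplify simplify)
    (I : Set (CodeCallInv.Inv ar D)) (hI : I.Finite)
    (inv : CodeCallInv.Inv ar D) (h : CodeCallInv.Entails I inv) :
    ∃ inv' ∈ CodeCallInv.powerOmega simplify I, CodeCallInv.Entails {inv'} inv := by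
  obtain ⟨i, hi, hinv⟩ := CodeCallInv.exists_derivable_entails hsimp hI h
  obtain ⟨i', hi', hent⟩ := CodeCallInv.exists_powerOmega_of_derivable hi
  exact ⟨i', hi', fun S hS => hinv S fun j hj => hj ▸ hent S hS⟩
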